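/- All spaces $X$ below are infinite, zero-dimensional (having a base of clopen sets), separable and metrizable. A cover of $X$ is a family $\mathcal U$ of subsets of $X$ with $X\notin\mathcal U$ and $\bigcup\mathcal U=X$. A cover $\mathcal U$ is a $\tau$-cover if each $x\in X$ belongs to infinitely many $U\in\mathcal U$ and, for all $x,y\in X$, at least one of the sets $\{U\in\mathcal U: x\in U,\ y\notin U\}$ and $\{U\in\mathcal U: y\in U,\ x\notin U\}$ is finite; it is a $\gamma$-cover if $\mathcal U$ is infinite and $\{U\in\mathcal U: x\notin U\}$ is finite for each $x\in X$. Let $\mathrm T$ and $\Gamma$ denote the collections of all countable open $\tau$-covers and of all countable open $\gamma$-covers of $X$, respectively. For collections $\mathcal A,\mathcal B$ of covers, $X$ satisfies $\mathsf S_1(\mathcal A,\mathcal B)$ if for each sequence $\mathcal U_n\in\mathcal A$ $(n\in\mathbb N)$ there are $U_n\in\mathcal U_n$ with $\{U_n:n\in\mathbb N\}\in\mathcal B$. Let $\mathfrak t$ be the minimal cardinality of a family of infinite subsets of $\mathbb N$ that is linearly (quasi-)ordered by $\subseteq^*$ (inclusion modulo finite sets) and has no infinite pseudo-intersection, i.e.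 no infinite $P\subseteq\mathbb N$ with $P\subseteq^* A$ for all members $A$ of the family. Theorem. The following are equivalent: 1. for every space $X$, $X$ satisfies $\mathsf S_1(\mathrm T,\mathrm T)$ if and only if it satisfies $\mathsf S_1(\mathrm T,\Gamma)$; 2. $\mathsf S_1(\mathrm T,\mathrm T)$ is preserved under finite unions: if a space $X$ is the union of finitely many infinite subspaces each satisfying $\mathsf S_1(\mathrm T,\mathrm T)$, then $X$ satisfies $\mathsf S_1(\mathrm T,\mathrm T)$; 3. $\mathsf S_1(\mathrm T,\mathrm T)$ is preserved under unions of size less than $\mathfrak t$: if a space $X$ is the union of fewer than $\mathfrak t$ infinite subspaces each satisfying $\mathsf S_1(\mathrm T,\mathrm T)$, then $X$ satisfies $\mathsf S_1(\mathrm T,\mathrm T)$. The same three-way equivalence holds with $\mathrm T,\Gamma$ replaced throughout by the collections of countable Borel $\tau$-covers and $\gamma$-covers, and also with $\mathrm T,\Gamma$ replaced throughout by the collections of countable clopen $\tau$-covers and $\gamma$-covers. -/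

import Mathlib

open Set

universe u

/-- The spaces under consideration: infinite, zero-dimensional (the clopen sets form a base),
separable and metrizable. -/
structure IsSetOfReals (X : Type u) [TopologicalSpace X] : Prop where
  infinite : Infinite X
  metrizable : TopologicalSpace.MetrizableSpace X
  separable : TopologicalSpace.SeparableSpace X
  zeroDimensional : TopologicalSpace.IsTopologicalBasis {U : Set X | IsClopen U}

section Covers

variable {X : Type u}

/-- A cover of `X`: a family of subsets with union `X` that does not contain `X` itself. -/
def IsCover (𝒰 : Set (Set X)) : Prop :=
  univ ∉ 𝒰 ∧ ⋃₀ 𝒰 = univ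

/-- A large cover: each point lies in infinitely many members. -/
def IsLargeCover (𝒰 : Set (Set X)) : Prop :=
  IsCover 𝒰 ∧ ∀ x : X, {U ∈ 𝒰 | x ∈ U}.Infinite

/-- A `τ`-cover. -/
def IsTauCover (𝒰 : Set (Set X)) : Prop :=
  IsLargeCover 𝒰 ∧ ∀ x y : X,
    {U ∈ 𝒰 | x ∈ U ∧ y ∉ U}.Finite ∨ {U ∈ 𝒰 | y ∈ U ∧ x ∉ U}.Finite

/-- A `γ`-cover. -/
def IsGammaCover (𝒰 : Set (Set X)) : Prop :=
  IsCover 𝒰 ∧ 𝒰.Infinite ∧ ∀ x : X, {U ∈ 𝒰 | x ∉ U}.Finite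

end Covers

section Classes

variable (X : Type u) [TopologicalSpace X]

/-- Countable open `τ`-covers. -/
def openTau : Set (Set (Set X)) :=
  {𝒰 | 𝒰.Countable ∧ (∀ U ∈ 𝒰, IsOpen U) ∧ IsTauCover 𝒰}

/-- Countable open `γ`-covers. -/
def openGamma : Set (Set (Set X)) :=
  {𝒰 | 𝒰.Countable ∧ (∀ U ∈ 𝒰, IsOpen U) ∧ IsGammaCover 𝒰}

/-- Countable Borel `τ`-covers. -/
def borelTau : Set (Set (Set X)) :=
  {𝒰 | 𝒰.Countable ∧ (∀ U ∈ 𝒰, @MeasurableSet X (borel X) U) ∧ IsTauCover 𝒰}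

/-- Countable Borel `γ`-covers. -/
def borelGamma : Set (Set (Set X)) :=
  {𝒰 | 𝒰.Countable ∧ (∀ U ∈ 𝒰, @MeasurableSet X (borel X) U) ∧ IsGammaCover 𝒰}

/-- Countable clopen `τ`-covers. -/
def clopenTau : Set (Set (Set X)) :=
  {𝒰 | 𝒰.Countable ∧ (∀ U ∈ 𝒰, IsClopen U) ∧ IsTauCover 𝒰}

/-- Countable clopen `γ`-covers. -/
def clopenGamma : Set (Set (Set X)) :=
  {𝒰 | 𝒰.Countable ∧ (∀ U ∈ 𝒰, IsClopen U) ∧ IsGammaCover 𝒰}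

end Classes

/-- The selection hypothesis `S₁(𝒜, ℬ)`: from each sequence of members of `𝒜` one can select one
element of each so that the set of all selected elements belongs to `ℬ`. -/
def SelectOne {X : Type u} (𝒜 ℬ : Set (Set (Set X))) : Prop :=
  ∀ 𝒰 : ℕ → Set (Set X), (∀ n, 𝒰 n ∈ 𝒜) →
    ∃ U : ℕ → Set X, (∀ n, U n ∈ 𝒰 n) ∧ range U ∈ ℬ

/-- Almost inclusion `A ⊆* B` of sets of natural numbers. -/
def AlmostSubset (A B : Set ℕ) : Prop := (A \ B).Finite

/-- The tower number `𝔱`: the least cardinality of a family of infinite subsets of `ℕ` that is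
linearly (quasi-)ordered by `⊆*` and has no infinite pseudo-intersection. -/
noncomputable def towerNumber : Cardinal.{0} :=
  sInf {κ | ∃ T : Set (Set ℕ), Cardinal.mk T = κ ∧ (∀ A ∈ T, A.Infinite) ∧
    (∀ A ∈ T, ∀ B ∈ T, AlmostSubset A B ∨ AlmostSubset B A) ∧
    ¬ ∃ P : Set ℕ, P.Infinite ∧ ∀ A ∈ T, AlmostSubset P A}

/-- Two properties of spaces are equivalent on the class of spaces under consideration. -/
def EquivalentProperties (P Q : ∀ (X : Type u) [TopologicalSpace X], Prop) : Prop :=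
  ∀ (X : Type u) [TopologicalSpace X], IsSetOfReals X → (P X ↔ Q X)

/-- If a space is the union of finitely many subspaces with the property `P`, it has `P`. -/
def PreservedByFiniteUnions (P : ∀ (X : Type u) [TopologicalSpace X], Prop) : Prop :=
  ∀ (X : Type u) [TopologicalSpace X], IsSetOfReals X →
    ∀ 𝒞 : Set (Set X), 𝒞.Finite → ⋃₀ 𝒞 = univ →
      (∀ A ∈ 𝒞, IsSetOfReals A ∧ P A) → P X

/-- If a space is the union of fewer than `𝔱` subspaces with the property `P`, it has `P`. -/
def PreservedByUnionsLtTower (P : ∀ (X : Type u) [TopologicalSpace X], Prop) : Prop :=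
  ∀ (X : Type u) [TopologicalSpace X], IsSetOfReals X →
    ∀ 𝒞 : Set (Set X), Cardinal.mk 𝒞 < Cardinal.lift.{u} towerNumber → ⋃₀ 𝒞 = univ →
      (∀ A ∈ 𝒞, IsSetOfReals A ∧ P A) → P X

/-! The key is that S₁(T,Γ) splits into two properties of sequences: every τ-sequence has a
γ-subsequence (`HasGammaSubsequences`), and one can select a γ-sequence from a sequence of
γ-sequences (`HasGammaSelections`). Under S₁(T,T) the first implies the second.

Both properties survive unions of fewer than 𝔱 pieces. For subsequences, order points by ⊆* of their
index sets: either some piece is coinitial and its pseudo-intersection serves all points, or each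
piece has a point below it, and these fewer than 𝔱 points have a pseudo-intersection. For
selections, good selections are coded by infinite sets of naturals that are dense for each piece,
and fewer than 𝔱 dense families have a common almost-refinement. This gives (1) → (3), while (3) →
(2) is ℵ₀ ≤ 𝔱.

For (2) → (1), take two copies of X. A τ-sequence of X is used on one copy at even stages and on the
other at odd stages, the idle copy being covered entirely. Comparability of points from different
copies in a selected τ-sequence forces a γ-subsequence along one parity.

Only closure properties of the class of covering sets matter, so the open, Borel and clopen cases
are one argument. -/

open Filter
open scoped Cardinal

/-! ### Almost inclusion, towers and 𝔱. -/

section AlmostInclusion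

theorem AlmostSubset.trans {A B D : Set ℕ} (h₁ : AlmostSubset A B) (h₂ : AlmostSubset B D) :
    AlmostSubset A D :=
  (h₁.union h₂).subset fun n hn => by
    by_cases hB : n ∈ B
    · exact Or.inr ⟨hB, hn.2⟩
    · exact Or.inl ⟨hn.1, hB⟩

theorem AlmostSubset.of_subset {A B : Set ℕ} (h : A ⊆ B) : AlmostSubset A B := by
  simp [AlmostSubset, sdiff_eq_empty.2 h]

theorem AlmostSubset.eventually {A B : Set ℕ} (h : AlmostSubset A B) :
    ∀ᶠ n in cofinite, n ∈ A → n ∈ B := by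
  refine h.subset fun n hn => ?_
  simpa using hn

theorem almostSubset_of_eventually {A B : Set ℕ} (h : ∀ᶠ n in cofinite, n ∈ A → n ∈ B) :
    AlmostSubset A B := by
  refine Set.Finite.subset h fun n hn => ?_
  simpa using hn

/-- A family indexed by fewer than `𝔱` indices and linearly quasi-ordered by `⊆*` has an infinite
pseudo-intersection. -/
theorem exists_pseudoIntersection {ι : Type u} (hι : #ι < Cardinal.lift.{u} towerNumber)
    (F : ι → Set ℕ) (hF : ∀ i, (F i).Infinite)
    (hlin : ∀ i j, AlmostSubset (F i) (F j) ∨ AlmostSubset (F j) (F i)) :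
    ∃ P : Set ℕ, P.Infinite ∧ ∀ i, AlmostSubset P (F i) := by
  have hlt : #(range F) < towerNumber := by
    have h := Cardinal.mk_range_le_lift (f := F)
    rw [Cardinal.lift_id'.{0, u}] at h
    exact Cardinal.lift_lt.{0, u}.1 (h.trans_lt hι)
  by_contra hP
  refine notMem_of_lt_csInf' hlt ⟨range F, rfl, ?_, ?_, ?_⟩
  · rintro _ ⟨i, rfl⟩
    exact hF i
  · rintro _ ⟨i, rfl⟩ _ ⟨j, rfl⟩
    exact hlin i j
  · rintro ⟨P, hP₁, hP₂⟩
    exact hP ⟨P, hP₁, fun i => hP₂ _ ⟨i, rfl⟩⟩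

/-- Fewer than `𝔱` dense families of infinite sets have a common almost-refinement. -/
theorem exists_almostSubset_of_dense {ι : Type u} (hι : #ι < Cardinal.lift.{u} towerNumber)
    (D : ι → Set ℕ → Prop)
    (hD : ∀ i, ∀ A : Set ℕ, A.Infinite → ∃ B ⊆ A, B.Infinite ∧ D i B) :
    ∃ P : Set ℕ, P.Infinite ∧ ∀ i, ∃ B, D i B ∧ AlmostSubset P B := by
  classical
  -- A ⊆*-decreasing family is built along a well-order: stage i refines a pseudo-intersection of
  -- the earlier stages into the i-th dense family. `epsilon` defers the existence proof to the
  -- induction.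
  let r : ι → ι → Prop := WellOrderingRel
  have wf : WellFounded r := IsWellFounded.wf
  let Good (i : ι) (prev : ∀ j, r j i → Set ℕ) (A : Set ℕ) : Prop :=
    A.Infinite ∧ D i A ∧ ∀ j hj, AlmostSubset A (prev j hj)
  let F : ι → Set ℕ := wf.fix fun i prev => Classical.epsilon (Good i prev)
  have hF : ∀ i, Good i (fun j _ => F j) (F i) := by
    intro i
    induction i using wf.induction with
    | _ i ih =>
      have hex : ∃ A, Good i (fun j _ => F j) A := by
        obtain ⟨P, hP, hPF⟩ := exists_pseudoIntersection
          (ι := {j // r j i}) ((Cardinal.mk_subtype_le _).trans_lt hι) (fun j => F j)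
          (fun j => (ih j j.2).1) (fun j k => by
            rcases trichotomous_of r j.1 k.1 with h | h | h
            · exact Or.inr ((ih k k.2).2.2 j h)
            · exact Or.inl (AlmostSubset.of_subset (by rw [h]))
            · exact Or.inl ((ih j j.2).2.2 k h))
        obtain ⟨B, hBP, hB, hDB⟩ := hD i P hP
        exact ⟨B, hB, hDB, fun j hj => (AlmostSubset.of_subset hBP).trans (hPF ⟨j, hj⟩)⟩
      have heq : F i = Classical.epsilon (Good i fun j _ => F j) := wf.fix_eq _ i
      rw [heq]
      exact Classical.epsilon_spec hex
  obtain ⟨P, hP, hPF⟩ := exists_pseudoIntersection hι F (fun i => (hF i).1) fun i j => by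
    rcases trichotomous_of r i j with h | h | h
    · exact Or.inr ((hF j).2.2 i h)
    · exact Or.inl (AlmostSubset.of_subset (by rw [h]))
    · exact Or.inl ((hF i).2.2 j h)
  exact ⟨P, hP, fun i => ⟨F i, (hF i).2.1, hPF i⟩⟩

/-- There is a `⊆*`-chain of infinite sets without infinite pseudo-intersection. -/
theorem exists_tower : ∃ T : Set (Set ℕ), (∀ A ∈ T, A.Infinite) ∧
    (∀ A ∈ T, ∀ B ∈ T, AlmostSubset A B ∨ AlmostSubset B A) ∧
    ¬ ∃ P : Set ℕ, P.Infinite ∧ ∀ A ∈ T, AlmostSubset P A := by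
  let S : Set (Set (Set ℕ)) := {T | (∀ A ∈ T, A.Infinite) ∧
    ∀ A ∈ T, ∀ B ∈ T, AlmostSubset A B ∨ AlmostSubset B A}
  obtain ⟨T, hT⟩ := zorn_subset S fun c hcS hc => by
    refine ⟨⋃₀ c, ⟨?_, ?_⟩, fun s hs => subset_sUnion_of_mem hs⟩
    · rintro A ⟨s, hs, hA⟩
      exact (hcS hs).1 A hA
    · rintro A ⟨s, hs, hA⟩ B ⟨t, ht, hB⟩
      rcases hc.total hs ht with h | h
      · exact (hcS ht).2 A (h hA) B hB
      · exact (hcS hs).2 A hA B (h hB)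
  refine ⟨T, hT.prop.1, hT.prop.2, ?_⟩
  rintro ⟨P, hP, hPT⟩
  let e := Nat.nth (· ∈ P)
  have he : StrictMono e := Nat.nth_strictMono hP
  have heP : ∀ n, e n ∈ P := Nat.nth_mem_of_infinite hP
  -- Every other element of P: Q lies below the whole chain, so maximality puts Q in it, although P
  -- is not almost contained in Q.
  let Q : Set ℕ := range fun n => e (2 * n)
  have hQinf : Q.Infinite := infinite_range_of_injective fun a b h => by
    have := he.injective h
    lia
  have hQP : AlmostSubset Q P := AlmostSubset.of_subset (by rintro _ ⟨n, rfl⟩; exact heP _)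
  have hPQ : ¬ AlmostSubset P Q := by
    have hinf : (range fun n => e (2 * n + 1)).Infinite := infinite_range_of_injective
      fun a b h => by
        have := he.injective h
        lia
    refine fun h => hinf (h.subset ?_)
    rintro _ ⟨n, rfl⟩
    refine ⟨heP _, ?_⟩
    rintro ⟨m, hm⟩
    have := he.injective hm
    lia
  have hmem : insert Q T ∈ S := by
    refine ⟨?_, ?_⟩
    · rintro A (rfl | hA)
      · exact hQinf
      · exact hT.prop.1 A hA
    · rintro A (rfl | hA) B (rfl | hB)
      · exact Or.inl (AlmostSubset.of_subset subset_rfl)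
      · exact Or.inl (hQP.trans (hPT B hB))
      · exact Or.inr (hQP.trans (hPT A hA))
      · exact hT.prop.2 A hA B hB
  exact hPQ (hPT Q (hT.le_of_ge hmem (subset_insert Q T) (mem_insert Q T)))

/-- A finite chain has a ⊆*-least element. `exists_tower` is needed because the infimum of an empty
set of cardinals is 0. -/
theorem aleph0_le_towerNumber : ℵ₀ ≤ towerNumber := by
  obtain ⟨T₀, h₀⟩ := exists_tower
  obtain ⟨T, hT, hinf, hlin, hno⟩ := csInf_mem (s := {κ | ∃ T : Set (Set ℕ), #T = κ ∧
    (∀ A ∈ T, A.Infinite) ∧ (∀ A ∈ T, ∀ B ∈ T, AlmostSubset A B ∨ AlmostSubset B A) ∧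
    ¬ ∃ P : Set ℕ, P.Infinite ∧ ∀ A ∈ T, AlmostSubset P A}) ⟨_, T₀, rfl, h₀⟩
  by_contra hlt
  have hfin : T.Finite := by
    rw [← Cardinal.lt_aleph0_iff_set_finite, hT]
    exact not_le.1 hlt
  refine hno ?_
  clear hno hT
  induction T, hfin using Set.Finite.induction_on with
  | empty => exact ⟨univ, infinite_univ, by simp⟩
  | @insert A T _ _ ih =>
    obtain ⟨P, hP, hPT⟩ := ih (fun B hB => hinf B (mem_insert_of_mem _ hB))
      fun B hB D hD => hlin B (mem_insert_of_mem _ hB) D (mem_insert_of_mem _ hD)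
    by_cases hA : ∀ B ∈ T, AlmostSubset A B
    · refine ⟨A, hinf A (mem_insert _ _), ?_⟩
      rintro B (rfl | hB)
      · exact AlmostSubset.of_subset subset_rfl
      · exact hA B hB
    · push Not at hA
      obtain ⟨B, hB, hAB⟩ := hA
      refine ⟨P, hP, ?_⟩
      rintro D (rfl | hD)
      · exact (hPT B hB).trans ((hlin D (mem_insert _ _) B (mem_insert_of_mem _ hB)).resolve_left
          hAB)
      · exact hPT D hD

end AlmostInclusion

/-! ### Covers as injective sequences. -/

section Sequences

variable {X : Type u} {ι : Type*}

/-- A sequence of sets is a `τ`-sequence if each point lies in infinitely many terms and the points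
are linearly quasi-ordered by inclusion modulo finite of their index sets. -/
def IsTauSeq (U : ι → Set X) : Prop :=
  (∀ x, ∃ᶠ i in cofinite, x ∈ U i) ∧ ∀ x y,
    (∀ᶠ i in cofinite, x ∈ U i → y ∈ U i) ∨ ∀ᶠ i in cofinite, y ∈ U i → x ∈ U i

/-- A sequence of sets is a `γ`-sequence if each point lies in almost all terms. -/
def IsGammaSeq (U : ι → Set X) : Prop :=
  ∀ x, ∀ᶠ i in cofinite, x ∈ U i

theorem IsGammaSeq.isTauSeq [Infinite ι] {U : ι → Set X} (h : IsGammaSeq U) : IsTauSeq U :=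
  ⟨fun x => (h x).frequently, fun x _ => Or.inr ((h x).mono fun _ hi _ => hi)⟩

theorem IsTauSeq.congr {U W : ι → Set X} (hU : IsTauSeq U)
    (h : ∀ x, ∀ᶠ i in cofinite, (x ∈ W i ↔ x ∈ U i)) : IsTauSeq W := by
  refine ⟨fun x => ((hU.1 x).and_eventually (h x)).mono fun i hi => hi.2.2 hi.1, fun x y => ?_⟩
  refine (hU.2 x y).imp (fun H => ?_) fun H => ?_ <;>
  · filter_upwards [H, h x, h y] with i h₁ h₂ h₃
    rwa [h₂, h₃]

theorem IsGammaSeq.congr {U W : ι → Set X} (hU : IsGammaSeq U)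
    (h : ∀ x, ∀ᶠ i in cofinite, (x ∈ W i ↔ x ∈ U i)) : IsGammaSeq W := fun x => by
  filter_upwards [hU x, h x] with i h₁ h₂
  rwa [h₂]

/-- Covers are sets and forget repetitions; for an injective enumeration, counting members is the
same as counting indices. -/
theorem frequently_mem_iff_infinite {W : ι → Set X} (hW : Function.Injective W)
    (p : Set X → Prop) : {V ∈ range W | p V}.Infinite ↔ ∃ᶠ i in cofinite, p (W i) := by
  have : {V ∈ range W | p V} = W '' {i | p (W i)} := by
    ext V
    constructor
    · rintro ⟨⟨i, rfl⟩, hi⟩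
      exact ⟨i, hi, rfl⟩
    · rintro ⟨i, hi, rfl⟩
      exact ⟨⟨i, rfl⟩, hi⟩
  rw [this, infinite_image_iff hW.injOn, frequently_cofinite_iff_infinite]

theorem eventually_iff_finite {W : ι → Set X} (hW : Function.Injective W)
    (p : Set X → Prop) : {V ∈ range W | p V}.Finite ↔ ∀ᶠ i in cofinite, ¬ p (W i) := by
  rw [← not_infinite, frequently_mem_iff_infinite hW, not_frequently]

theorem isTauCover_range_iff {W : ι → Set X} (hW : Function.Injective W) :
    IsTauCover (range W) ↔ IsCover (range W) ∧ IsTauSeq W := by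
  simp only [IsTauCover, IsLargeCover, IsTauSeq, frequently_mem_iff_infinite hW,
    eventually_iff_finite hW, not_and, not_not, and_assoc]

theorem isGammaCover_range_iff [Infinite ι] {W : ι → Set X} (hW : Function.Injective W) :
    IsGammaCover (range W) ↔ IsCover (range W) ∧ IsGammaSeq W := by
  simp only [IsGammaCover, IsGammaSeq, eventually_iff_finite hW, not_not,
    infinite_range_of_injective hW, true_and]

theorem IsTauSeq.isCover_range {W : ι → Set X} (hW : IsTauSeq W) (h : ∀ i, W i ≠ univ) :
    IsCover (range W) := by
  refine ⟨?_, eq_univ_of_forall fun x => ?_⟩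
  · rintro ⟨i, hi⟩
    exact h i hi
  · obtain ⟨i, hi⟩ := (hW.1 x).exists
    exact ⟨W i, ⟨i, rfl⟩, hi⟩

theorem IsGammaCover.isTauCover {𝒰 : Set (Set X)} (h : IsGammaCover 𝒰) : IsTauCover 𝒰 := by
  refine ⟨⟨h.1, fun x => ?_⟩, fun x y => Or.inl ((h.2.2 y).subset fun U hU => ⟨hU.1, hU.2.2⟩)⟩
  have := h.2.1.sdiff (h.2.2 x)
  refine this.mono fun U hU => ⟨hU.1, ?_⟩
  by_contra hx
  exact hU.2 ⟨hU.1, hx⟩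

/-- A countable `τ`-cover of a nonempty set has an injective enumeration. -/
theorem IsTauCover.exists_enumeration [Nonempty X] {𝒰 : Set (Set X)} (hc : 𝒰.Countable)
    (h : IsTauCover 𝒰) : ∃ U : ℕ → Set X, Function.Injective U ∧ range U = 𝒰 := by
  obtain ⟨x⟩ := ‹Nonempty X›
  have hinf : 𝒰.Infinite := (h.1.2 x).mono fun U hU => hU.1
  have := hinf.to_subtype
  have := hc.to_subtype
  obtain ⟨e⟩ := nonempty_equiv_of_countable (α := ℕ) (β := 𝒰)
  exact ⟨fun n => e n, Subtype.val_injective.comp e.injective, by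
    ext V
    constructor
    · rintro ⟨n, rfl⟩
      exact (e n).2
    · exact fun hV => ⟨e.symm ⟨V, hV⟩, by simp⟩⟩

end Sequences

/-! ### Uniform treatment of open, Borel and clopen covers. -/

section Pointclasses

/-- The properties of the classes of open, Borel and clopen sets that are needed to treat the three
kinds of covers simultaneously. -/
structure IsPointclass (C : ∀ (X : Type u) [TopologicalSpace X], Set X → Prop) : Prop where
  preimage : ∀ {X Y : Type u} [TopologicalSpace X] [TopologicalSpace Y] {f : X → Y} {s : Set Y},
    Continuous f → C Y s → C X (f ⁻¹' s)
  inter : ∀ {X : Type u} [TopologicalSpace X] {s t : Set X}, C X s → C X t → C X (s ∩ t)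
  union : ∀ {X : Type u} [TopologicalSpace X] {s t : Set X}, C X s → C X t → C X (s ∪ t)
  of_isClopen : ∀ {X : Type u} [TopologicalSpace X] {s : Set X}, IsClopen s → C X s

variable (C : ∀ (X : Type u) [TopologicalSpace X], Set X → Prop)

/-- Countable `τ`-covers by sets from the class `C`. -/
def tauCovers (X : Type u) [TopologicalSpace X] : Set (Set (Set X)) :=
  {𝒰 | 𝒰.Countable ∧ (∀ U ∈ 𝒰, C X U) ∧ IsTauCover 𝒰}

/-- Countable `γ`-covers by sets from the class `C`. -/
def gammaCovers (X : Type u) [TopologicalSpace X] : Set (Set (Set X)) :=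
  {𝒰 | 𝒰.Countable ∧ (∀ U ∈ 𝒰, C X U) ∧ IsGammaCover 𝒰}

/-- Every `τ`-sequence of sets from `C` has a `γ`-subsequence. -/
def HasGammaSubsequences (X : Type u) [TopologicalSpace X] : Prop :=
  ∀ U : ℕ → Set X, (∀ n, C X (U n)) → IsTauSeq U →
    ∃ P : Set ℕ, P.Infinite ∧ ∀ x, ∀ᶠ n in cofinite, n ∈ P → x ∈ U n

/-- From each sequence of `γ`-sequences of sets from `C` one can select a `γ`-sequence. -/
def HasGammaSelections (X : Type u) [TopologicalSpace X] : Prop :=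
  ∀ U : ℕ → ℕ → Set X, (∀ n m, C X (U n m)) → (∀ n, IsGammaSeq (U n)) →
    ∃ f : ℕ → ℕ, IsGammaSeq fun n => U n (f n)

end Pointclasses

/-! ### Making sequences of sets injective. -/

section Modification

variable {C : ∀ (X : Type u) [TopologicalSpace X], Set X → Prop}
  {X : Type u} [TopologicalSpace X]

theorem IsSetOfReals.exists_disjoint_isClopen (hX : IsSetOfReals X) :
    ∃ D : ℕ → Set X, (∀ n, IsClopen (D n)) ∧ (∀ n, (D n).Nonempty) ∧
      ∀ n m x, x ∈ D n → x ∈ D m → n = m := by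
  have := hX.infinite
  have := hX.metrizable
  obtain ⟨U, hinf, hopen, hdisj⟩ := exists_seq_infinite_isOpen_pairwise_disjoint X
  have key : ∀ n, ∃ V : Set X, IsClopen V ∧ V.Nonempty ∧ V ⊆ U n := fun n => by
    obtain ⟨x, hx⟩ := (hinf n).nonempty
    obtain ⟨V, hV, hxV, hVU⟩ := hX.zeroDimensional.exists_subset_of_mem_open hx (hopen n)
    exact ⟨V, hV, ⟨x, hxV⟩, hVU⟩
  choose D hD hne hDU using key
  refine ⟨D, hD, hne, fun n m x hn hm => ?_⟩
  by_contra hnm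
  exact disjoint_left.1 (hdisj hnm) (hDU n hn) (hDU m hm)

/-- A sequence of sets can be made injective, with all terms different from the whole space, such
that each point is affected in finitely many terms only. -/
theorem IsSetOfReals.exists_injective_modification_nat (hX : IsSetOfReals X) (hC : IsPointclass C)
    (U : ℕ → Set X) (hU : ∀ n, C X (U n)) :
    ∃ W : ℕ → Set X, Function.Injective W ∧ (∀ n, C X (W n)) ∧ (∀ n, W n ≠ univ) ∧
      ∀ x, ∀ᶠ n in cofinite, (x ∈ W n ↔ x ∈ U n) := by
  obtain ⟨D, hD, hne, hdisj⟩ := hX.exists_disjoint_isClopen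
  -- Only W n is altered on row n. For m < n, the set E n m witnesses W n ≠ W m: it is removed from
  -- W n if contained in U m and added otherwise. E n n is removed to keep W n ≠ univ. Rows are
  -- disjoint, so each point is affected at most once.
  let E : ℕ → ℕ → Set X := fun n m => D (Nat.pair n m)
  have hE : ∀ {n m n' m' x}, x ∈ E n m → x ∈ E n' m' → n = n' ∧ m = m' := fun h h' =>
    Nat.pair_eq_pair.1 (hdisj _ _ _ h h')
  let RI : ℕ → Set ℕ := fun n => {m | m ≤ n ∧ (m = n ∨ E n m ⊆ U m)}
  let AI : ℕ → Set ℕ := fun n => {m | m < n ∧ ¬ E n m ⊆ U m}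
  let R : ℕ → Set X := fun n => ⋃ m ∈ RI n, E n m
  let A : ℕ → Set X := fun n => ⋃ m ∈ AI n, E n m
  have hR : ∀ n, IsClopen (R n) := fun n =>
    ((finite_le_nat n).subset fun m hm => hm.1).isClopen_biUnion fun m _ => hD _
  have hA : ∀ n, IsClopen (A n) := fun n =>
    ((finite_lt_nat n).subset fun m hm => hm.1).isClopen_biUnion fun m _ => hD _
  have hRE : ∀ {n x}, x ∈ R n → ∃ m ∈ RI n, x ∈ E n m := fun hx => by simpa [R] using hx
  have hAE : ∀ {n x}, x ∈ A n → ∃ m ∈ AI n, x ∈ E n m := fun hx => by simpa [A] using hx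
  have hER : ∀ {n m x}, m ∈ RI n → x ∈ E n m → x ∈ R n := fun hm hx => mem_biUnion hm hx
  have hEA : ∀ {n m x}, m ∈ AI n → x ∈ E n m → x ∈ A n := fun hm hx => mem_biUnion hm hx
  let W : ℕ → Set X := fun n => U n ∩ (R n)ᶜ ∪ A n
  have hlt : ∀ n m, m < n → W n ≠ W m := by
    intro n m hmn heq
    have hWm : ∀ x ∈ E n m, (x ∈ W m ↔ x ∈ U m) := fun x hx => by
      have h₁ : x ∉ R m := fun h => by
        obtain ⟨k, -, hk⟩ := hRE h
        exact hmn.ne' (hE hx hk).1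
      have h₂ : x ∉ A m := fun h => by
        obtain ⟨k, -, hk⟩ := hAE h
        exact hmn.ne' (hE hx hk).1
      simp [W, h₁, h₂]
    by_cases hsub : E n m ⊆ U m
    · obtain ⟨x, hx⟩ := hne (Nat.pair n m)
      have hx' : x ∈ W n := heq ▸ (hWm x hx).2 (hsub hx)
      rcases hx' with h | h
      · exact h.2 (hER ⟨hmn.le, Or.inr hsub⟩ hx)
      · obtain ⟨k, hk, hxk⟩ := hAE h
        obtain rfl := (hE hx hxk).2
        exact hk.2 hsub
    · obtain ⟨x, hx, hxU⟩ := not_subset.1 hsub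
      exact hxU ((hWm x hx).1 (heq ▸ Or.inr (hEA ⟨hmn, hsub⟩ hx)))
  refine ⟨W, fun n m h => ?_, fun n => ?_, fun n h => ?_, fun x => ?_⟩
  · rcases lt_trichotomy n m with h' | h' | h'
    · exact (hlt _ _ h' h.symm).elim
    · exact h'
    · exact (hlt _ _ h' h).elim
  · exact hC.union (hC.inter (hU n) (hC.of_isClopen (hR n).compl)) (hC.of_isClopen (hA n))
  · obtain ⟨x, hx⟩ := hne (Nat.pair n n)
    rcases (h ▸ mem_univ x : x ∈ W n) with h | h
    · exact h.2 (hER ⟨le_rfl, Or.inl rfl⟩ hx)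
    · obtain ⟨k, hk, hxk⟩ := hAE h
      exact hk.1.ne' (hE hx hxk).2
  · have hex : ∀ n, ¬ (x ∈ W n ↔ x ∈ U n) → ∃ m, x ∈ E n m := fun n hn => by
      by_contra! hall
      refine hn ?_
      have h₁ : x ∉ R n := fun h => by
        obtain ⟨k, -, hk⟩ := hRE h
        exact hall k hk
      have h₂ : x ∉ A n := fun h => by
        obtain ⟨k, -, hk⟩ := hAE h
        exact hall k hk
      simp [W, h₁, h₂]
    refine Set.Subsingleton.finite fun n hn n' hn' => ?_
    obtain ⟨m, hm⟩ := hex n hn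
    obtain ⟨m', hm'⟩ := hex n' hn'
    exact (hE hm hm').1

theorem IsSetOfReals.exists_injective_modification {ι : Type*} [Denumerable ι]
    (hX : IsSetOfReals X) (hC : IsPointclass C) (U : ι → Set X) (hU : ∀ i, C X (U i)) :
    ∃ W : ι → Set X, Function.Injective W ∧ (∀ i, C X (W i)) ∧ (∀ i, W i ≠ univ) ∧
      ∀ x, ∀ᶠ i in cofinite, (x ∈ W i ↔ x ∈ U i) := by
  let e := Denumerable.eqv ι
  obtain ⟨W, hinj, hWC, hne, hW⟩ :=
    hX.exists_injective_modification_nat hC (fun n => U (e.symm n)) fun n => hU _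
  refine ⟨fun i => W (e i), hinj.comp e.injective, fun i => hWC _, fun i => hne _, fun x => ?_⟩
  simpa using e.injective.tendsto_cofinite.eventually (hW x)

end Modification

/-! ### Selection principles in terms of sequences. -/

section Selections

variable {C : ∀ (X : Type u) [TopologicalSpace X], Set X → Prop}
  {X : Type u} [TopologicalSpace X]

theorem injective_pair_left (n : ℕ) : Function.Injective fun m : ℕ => (n, m) :=
  fun _ _ h => (Prod.ext_iff.1 h).2

theorem injective_graph (f : ℕ → ℕ) : Function.Injective fun n => (n, f n) :=
  fun _ _ h => (Prod.ext_iff.1 h).1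

theorem gammaCovers_subset_tauCovers : gammaCovers C X ⊆ tauCovers C X :=
  fun _ h => ⟨h.1, h.2.1, h.2.2.isTauCover⟩

theorem SelectOne.mono {X : Type u} {𝒜 𝒜' ℬ ℬ' : Set (Set (Set X))} (h : SelectOne 𝒜 ℬ) (h𝒜 : 𝒜' ⊆ 𝒜)
    (hℬ : ℬ ⊆ ℬ') : SelectOne 𝒜' ℬ' := fun 𝒰 h𝒰 => by
  obtain ⟨U, hU, hr⟩ := h 𝒰 fun n => h𝒜 (h𝒰 n)
  exact ⟨U, hU, hℬ hr⟩

theorem IsPointclass.setOf_forall_le (hC : IsPointclass C) {U : ℕ → Set X}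
    (hU : ∀ n, C X (U n)) (n : ℕ) : C X {x | ∀ k ≤ n, x ∈ U k} := by
  induction n with
  | zero => simpa using hU 0
  | succ n ih =>
    have : {x | ∀ k ≤ n + 1, x ∈ U k} = {x | ∀ k ≤ n, x ∈ U k} ∩ U (n + 1) := by
      ext x
      simp only [mem_ofPred_eq, mem_inter_iff, Nat.le_succ_iff_eq_or_le]
      grind
    rw [this]
    exact hC.inter ih (hU _)

/-- `S₁(T, T)` in terms of sequences. -/
theorem SelectOne.exists_isTauSeq (hX : IsSetOfReals X) (hC : IsPointclass C)
    (h : SelectOne (tauCovers C X) (tauCovers C X)) (U : ℕ → ℕ → Set X)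
    (hUC : ∀ n m, C X (U n m)) (hU : ∀ n, IsTauSeq (U n)) :
    ∃ f : ℕ → ℕ, IsTauSeq fun n => U n (f n) := by
  -- Modifying the whole array at once makes every selection n ↦ (n, f n) injective, not just every
  -- row.
  obtain ⟨W, hinj, hWC, hne, hW⟩ :=
    hX.exists_injective_modification hC (fun p : ℕ × ℕ => U p.1 p.2) fun p => hUC _ _
  have hWτ : ∀ n, IsTauSeq fun m => W (n, m) := fun n => (hU n).congr fun x =>
    (injective_pair_left n).tendsto_cofinite.eventually (hW x)
  obtain ⟨V, hV, hVτ⟩ := h (fun n => range fun m => W (n, m)) fun n =>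
    ⟨countable_range _, by rintro _ ⟨m, rfl⟩; exact hWC _,
      (isTauCover_range_iff (hinj.comp (injective_pair_left n))).2
        ⟨(hWτ n).isCover_range fun _ => hne _, hWτ n⟩⟩
  choose f hf using hV
  obtain rfl : (fun n => W (n, f n)) = V := funext hf
  have := ((isTauCover_range_iff (hinj.comp (injective_graph f))).1 hVτ.2.2).2
  exact ⟨f, this.congr fun x =>
    ((injective_graph f).tendsto_cofinite.eventually (hW x)).mono fun n hn => hn.symm⟩

/-- `S₁(Γ, Γ)` in terms of sequences. -/
theorem SelectOne.hasGammaSelections (hX : IsSetOfReals X) (hC : IsPointclass C)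
    (h : SelectOne (gammaCovers C X) (gammaCovers C X)) : HasGammaSelections C X := by
  intro U hUC hU
  obtain ⟨W, hinj, hWC, hne, hW⟩ :=
    hX.exists_injective_modification hC (fun p : ℕ × ℕ => U p.1 p.2) fun p => hUC _ _
  have hWγ : ∀ n, IsGammaSeq fun m => W (n, m) := fun n => (hU n).congr fun x =>
    (injective_pair_left n).tendsto_cofinite.eventually (hW x)
  obtain ⟨V, hV, hVγ⟩ := h (fun n => range fun m => W (n, m)) fun n =>
    ⟨countable_range _, by rintro _ ⟨m, rfl⟩; exact hWC _,
      (isGammaCover_range_iff (hinj.comp (injective_pair_left n))).2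
        ⟨(hWγ n).isTauSeq.isCover_range fun _ => hne _, hWγ n⟩⟩
  choose f hf using hV
  obtain rfl : (fun n => W (n, f n)) = V := funext hf
  have := ((isGammaCover_range_iff (hinj.comp (injective_graph f))).1 hVγ.2.2).2
  exact ⟨f, this.congr fun x =>
    ((injective_graph f).tendsto_cofinite.eventually (hW x)).mono fun n hn => hn.symm⟩

/-- Select from a constant sequence of covers; a γ-cover is infinite, so infinitely many indices are
used. -/
theorem SelectOne.hasGammaSubsequences (hX : IsSetOfReals X) (hC : IsPointclass C)
    (h : SelectOne (tauCovers C X) (gammaCovers C X)) : HasGammaSubsequences C X := by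
  intro U hUC hU
  obtain ⟨W, hinj, hWC, hne, hW⟩ := hX.exists_injective_modification hC U hUC
  have hWτ : IsTauSeq W := hU.congr hW
  obtain ⟨V, hV, hVγ⟩ := h (fun _ => range W) fun _ => ⟨countable_range _,
    by rintro _ ⟨m, rfl⟩; exact hWC _,
    (isTauCover_range_iff hinj).2 ⟨hWτ.isCover_range hne, hWτ⟩⟩
  choose f hf using hV
  obtain rfl : (fun n => W (f n)) = V := funext hf
  refine ⟨range f, fun hfin => hVγ.2.2.2.1 ?_, fun x => ?_⟩
  · rw [show (fun n => W (f n)) = W ∘ f from rfl, range_comp]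
    exact hfin.image W
  · have hfin : {n | n ∈ range f ∧ x ∉ W n}.Finite := by
      refine Set.Finite.of_finite_image ((hVγ.2.2.2.2 x).subset ?_) hinj.injOn
      rintro _ ⟨_, ⟨⟨k, rfl⟩, hk⟩, rfl⟩
      exact ⟨⟨k, rfl⟩, hk⟩
    filter_upwards [hfin.compl_mem_cofinite, hW x] with n hn hn' hmem
    rw [← hn']
    by_contra hx
    exact hn ⟨hmem, hx⟩

/-- Thin each cover to a γ-subsequence, then select from these. -/
theorem selectOne_tau_gamma (hX : IsSetOfReals X) (hsub : HasGammaSubsequences C X)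
    (hsel : HasGammaSelections C X) : SelectOne (tauCovers C X) (gammaCovers C X) := by
  intro 𝒰 h𝒰
  have := hX.infinite
  choose U hinj hU using fun n => (h𝒰 n).2.2.exists_enumeration (h𝒰 n).1
  have hmem : ∀ n m, U n m ∈ 𝒰 n := fun n m => hU n ▸ mem_range_self m
  have hUτ : ∀ n, IsTauSeq (U n) := fun n =>
    ((isTauCover_range_iff (hinj n)).1 ((hU n).symm ▸ (h𝒰 n).2.2)).2
  choose P hP hPγ using fun n => hsub (U n) (fun m => (h𝒰 n).2.1 _ (hmem n m)) (hUτ n)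
  let e : ℕ → ℕ → ℕ := fun n => Nat.nth (· ∈ P n)
  obtain ⟨f, hf⟩ := hsel (fun n m => U n (e n m)) (fun n m => (h𝒰 n).2.1 _ (hmem n _))
    fun n x => ((Nat.nth_injective (hP n)).tendsto_cofinite.eventually (hPγ n x)).mono
      fun m hm => hm (Nat.nth_mem_of_infinite (hP n) m)
  refine ⟨fun n => U n (e n (f n)), fun n => hmem n _, countable_range _, ?_, ⟨?_, ?_⟩, ?_, ?_⟩
  · rintro _ ⟨n, rfl⟩
    exact (h𝒰 n).2.1 _ (hmem n _)
  · rintro ⟨n, hn⟩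
    exact (h𝒰 n).2.2.1.1.1 (hn ▸ hmem n _)
  · refine eq_univ_of_forall fun x => ?_
    obtain ⟨n, hn⟩ := (hf x).exists
    exact ⟨_, ⟨n, rfl⟩, hn⟩
  -- If only finitely many sets were selected, choose a point missed by each. Some term contains all
  -- these points, including the one it misses.
  · intro hfin
    have hpt : ∀ V ∈ range fun n => U n (e n (f n)), ∃ x, x ∉ V := by
      rintro _ ⟨n, rfl⟩
      by_contra! hall
      exact (h𝒰 n).2.2.1.1.1 (eq_univ_of_forall hall ▸ hmem n _)
    choose! x hx using hpt
    have hall := (eventually_all_finite hfin).2 fun V _ => hf (x V)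
    obtain ⟨n, hn⟩ := hall.exists
    exact hx _ ⟨n, rfl⟩ (hn _ ⟨n, rfl⟩)
  · intro x
    refine Set.Finite.subset (Set.Finite.image (fun n => U n (e n (f n))) (hf x)) ?_
    rintro _ ⟨⟨n, rfl⟩, hn⟩
    exact ⟨n, hn, rfl⟩

/-- Under `S₁(T, T)`, the existence of `γ`-subsequences implies `S₁(Γ, Γ)`. -/
theorem HasGammaSubsequences.hasGammaSelections (hsub : HasGammaSubsequences C X)
    (hX : IsSetOfReals X) (hC : IsPointclass C)
    (h : SelectOne (tauCovers C X) (tauCovers C X)) : HasGammaSelections C X := by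
  intro U hUC hU
  -- With cumulative intersections, a choice made at a later stage also serves earlier rows, so row
  -- n can borrow the choice at some g n > n in P.
  let V : ℕ → ℕ → Set X := fun n m => {x | ∀ k ≤ n, x ∈ U k m}
  have hVC : ∀ n m, C X (V n m) := fun n m => hC.setOf_forall_le (fun k => hUC k m) n
  have hV : ∀ n, IsGammaSeq (V n) := fun n x =>
    (eventually_all_finite (finite_le_nat n)).2 fun k _ => hU k x
  obtain ⟨f, hf⟩ := h.exists_isTauSeq hX hC V hVC fun n => (hV n).isTauSeq
  obtain ⟨P, hP, hPγ⟩ := hsub _ (fun n => hVC n (f n)) hf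
  choose g hgP hg using fun n => hP.exists_gt n
  refine ⟨fun n => f (g n), fun x => ?_⟩
  have hx := hPγ x
  rw [Nat.cofinite_eq_atTop] at hx ⊢
  obtain ⟨N, hN⟩ := eventually_atTop.1 hx
  filter_upwards [eventually_ge_atTop N] with n hn
  exact hN (g n) (hn.trans (hg n).le) (hgP n) n (hg n).le

end Selections

/-! ### Unions of fewer than 𝔱 pieces. -/

section Unions

variable {C : ∀ (X : Type u) [TopologicalSpace X], Set X → Prop}
  {X : Type u} [TopologicalSpace X]

theorem HasGammaSubsequences.of_sUnion (hC : IsPointclass C) {𝒞 : Set (Set X)}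
    (hcard : #𝒞 < Cardinal.lift.{u} towerNumber) (hcov : ⋃₀ 𝒞 = univ)
    (h : ∀ A ∈ 𝒞, HasGammaSubsequences C A) : HasGammaSubsequences C X := by
  intro U hUC hU
  have hpi : ∀ A : 𝒞, ∃ P : Set ℕ, P.Infinite ∧
      ∀ x : (A : Set X), ∀ᶠ n in cofinite, n ∈ P → (x : X) ∈ U n := fun A =>
    h A A.2 (fun n => Subtype.val ⁻¹' U n) (fun n => hC.preimage continuous_subtype_val (hUC n))
      ⟨fun x => hU.1 x, fun x y => hU.2 x y⟩
  have hmem : ∀ x, ∃ A ∈ 𝒞, x ∈ A := fun x => mem_sUnion.1 (hcov.symm ▸ mem_univ x)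
  by_cases hcoinit : ∃ A : 𝒞, ∀ y : X, ∃ x ∈ (A : Set X),
      ∀ᶠ n in cofinite, x ∈ U n → y ∈ U n
  · obtain ⟨A, hA⟩ := hcoinit
    obtain ⟨P, hP, hPA⟩ := hpi A
    refine ⟨P, hP, fun y => ?_⟩
    obtain ⟨x, hx, hxy⟩ := hA y
    filter_upwards [hPA ⟨x, hx⟩, hxy] with n h₁ h₂ hn
    exact h₂ (h₁ hn)
  -- No piece is coinitial: by linearity each A has a point y A whose index set is almost contained
  -- in that of every point of A.
  · have hex : ∀ A : 𝒞, ∃ y : X, ∀ x ∈ (A : Set X),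
        ¬ ∀ᶠ n in cofinite, x ∈ U n → y ∈ U n := fun A => by
      by_contra! hA
      exact hcoinit ⟨A, hA⟩
    choose y hy using hex
    obtain ⟨P, hP, hPy⟩ := exists_pseudoIntersection hcard (fun A => {n | y A ∈ U n})
      (fun A => frequently_cofinite_iff_infinite.1 (hU.1 (y A)))
      fun A B => (hU.2 (y A) (y B)).imp almostSubset_of_eventually almostSubset_of_eventually
    refine ⟨P, hP, fun x => ?_⟩
    obtain ⟨A, hA, hxA⟩ := hmem x
    have hyx := (hU.2 x (y ⟨A, hA⟩)).resolve_left fun H => hy ⟨A, hA⟩ x hxA H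
    filter_upwards [(hPy ⟨A, hA⟩).eventually, hyx] with n h₁ h₂ hn
    exact h₂ (h₁ hn)

/-- An infinite set B codes a selection: m ∈ B is the choice for the row numbered by its position in
B. Sets that work for a given piece are dense, so one P is almost contained in a suitable B for
every piece. -/
theorem HasGammaSelections.of_sUnion (hC : IsPointclass C) {𝒞 : Set (Set X)}
    (hcard : #𝒞 < Cardinal.lift.{u} towerNumber) (hcov : ⋃₀ 𝒞 = univ)
    (h : ∀ A ∈ 𝒞, HasGammaSelections C A) : HasGammaSelections C X := by
  intro U hUC hU
  have hmem : ∀ x, ∃ A ∈ 𝒞, x ∈ A := fun x => mem_sUnion.1 (hcov.symm ▸ mem_univ x)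
  let V : ℕ → ℕ → Set X := fun n m => {x | ∀ k ≤ n, x ∈ U k m}
  have hVanti : ∀ {n n' m x}, n ≤ n' → x ∈ V n' m → x ∈ V n m :=
    fun hnn' hx k hk => hx k (hk.trans hnn')
  have hV : ∀ n, IsGammaSeq (V n) := fun n x =>
    (eventually_all_finite (finite_le_nat n)).2 fun k _ => hU k x
  obtain ⟨P, hP, hPD⟩ := exists_almostSubset_of_dense hcard
    (fun A B => ∀ x ∈ (A : Set X), ∀ᶠ m in atTop, m ∈ B → x ∈ V (B ∩ Iio m).ncard m)
    fun A S hS => by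
      let e := Nat.nth (· ∈ S)
      have he : StrictMono e := Nat.nth_strictMono hS
      -- The shift by n forces the selected indices to infinity, so that a strictly increasing
      -- subsequence exists.
      obtain ⟨f, hf⟩ := h A A.2 (fun n j => Subtype.val ⁻¹' V n (e (n + j)))
        (fun n j => hC.preimage continuous_subtype_val
          (hC.setOf_forall_le (fun k => hUC k _) n))
        fun n x => (he.injective.comp (add_right_injective n)).tendsto_cofinite.eventually
          (hV n x)
      have htend : Tendsto (fun n => e (n + f n)) atTop atTop :=
        tendsto_atTop_mono (fun n => (Nat.le_add_right n (f n)).trans (he.id_le _)) tendsto_id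
      obtain ⟨φ, hφ, hφm⟩ := strictMono_subseq_of_tendsto_atTop htend
      refine ⟨range ((fun n => e (n + f n)) ∘ φ), ?_, infinite_range_of_injective hφm.injective,
        fun x hx => ?_⟩
      · rintro _ ⟨k, rfl⟩
        exact Nat.nth_mem_of_infinite hS _
      · have hfx := hf ⟨x, hx⟩
        rw [Nat.cofinite_eq_atTop] at hfx
        obtain ⟨N, hN⟩ := eventually_atTop.1 hfx
        filter_upwards [eventually_ge_atTop (e (φ N + f (φ N)))] with m hm hmB
        obtain ⟨k, rfl⟩ := hmB
        have hNk : N ≤ k := hφm.le_iff_le.1 hm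
        -- The element at stage k has at most k ≤ φ k predecessors, and it was chosen for row φ k; V
        -- decreases in the row.
        have hcount : (range ((fun n => e (n + f n)) ∘ φ) ∩
            Iio (((fun n => e (n + f n)) ∘ φ) k)).ncard ≤ k := by
          have hsub : range ((fun n => e (n + f n)) ∘ φ) ∩
              Iio (((fun n => e (n + f n)) ∘ φ) k) ⊆
              ((fun n => e (n + f n)) ∘ φ) '' Iio k := by
            rintro _ ⟨⟨i, rfl⟩, hi⟩
            exact ⟨i, hφm.lt_iff_lt.1 hi, rfl⟩
          calc _ ≤ _ := ncard_le_ncard hsub ((finite_Iio k).image _)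
            _ ≤ (Iio k).ncard := ncard_image_le (finite_Iio k)
            _ = k := by simp
        exact hVanti (hcount.trans (hφ.id_le k))
          (hN (φ k) (hNk.trans (hφ.id_le k)))
  let p := Nat.nth (· ∈ P)
  have hp : StrictMono p := Nat.nth_strictMono hP
  have hpP : ∀ n, p n ∈ P := Nat.nth_mem_of_infinite hP
  -- Of the 2n predecessors of p (2n) in P, all but at most |P \ B| lie in B. Once n ≥ |P \ B|, at
  -- least n of them do, so the row reached is at least n.
  refine ⟨fun n => p (2 * n), fun x => ?_⟩
  obtain ⟨A, hA, hxA⟩ := hmem x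
  obtain ⟨B, hB, hPB⟩ := hPD ⟨A, hA⟩
  have htend : Tendsto (fun n => p (2 * n)) atTop atTop :=
    tendsto_atTop_mono (fun n => (by lia : n ≤ 2 * n).trans (hp.id_le _)) tendsto_id
  have hB' := htend.eventually (hB x hxA)
  have hPB' := htend.eventually (Nat.cofinite_eq_atTop ▸ hPB.eventually)
  rw [Nat.cofinite_eq_atTop]
  filter_upwards [hB', hPB', eventually_ge_atTop (P \ B).ncard] with n h₁ h₂ h₃
  refine hVanti ?_ (h₁ (h₂ (hpP _))) n le_rfl
  have hfin : (B ∩ Iio (p (2 * n))).Finite := (finite_Iio _).subset inter_subset_right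
  have hsub : p '' Iio (2 * n) ⊆ B ∩ Iio (p (2 * n)) ∪ P \ B := by
    rintro _ ⟨i, hi, rfl⟩
    by_cases hiB : p i ∈ B
    · exact Or.inl ⟨hiB, hp hi⟩
    · exact Or.inr ⟨hpP i, hiB⟩
  have hle := (ncard_le_ncard hsub (hfin.union hPB)).trans (ncard_union_le _ _)
  rw [ncard_image_of_injective _ hp.injective, ncard_Iio_nat] at hle
  lia

end Unions

/-! ### Homeomorphism invariance and the doubled space. -/

section Homeomorphisms

variable {C : ∀ (X : Type u) [TopologicalSpace X], Set X → Prop}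
  {X Y : Type u} [TopologicalSpace X] [TopologicalSpace Y]

theorem preimage_mem_tauCovers (hC : IsPointclass C) (e : X ≃ₜ Y) {𝒰 : Set (Set Y)}
    (h : 𝒰 ∈ tauCovers C Y) : preimage e '' 𝒰 ∈ tauCovers C X := by
  have hinj : Function.Injective (preimage e) := e.surjective.preimage_injective
  have heq : ∀ p : Set X → Prop, {U ∈ preimage e '' 𝒰 | p U} =
      preimage e '' {U ∈ 𝒰 | p (e ⁻¹' U)} := fun p => by
    ext V
    constructor
    · rintro ⟨⟨U, hU, rfl⟩, hp⟩
      exact ⟨U, ⟨hU, hp⟩, rfl⟩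
    · rintro ⟨U, ⟨hU, hp⟩, rfl⟩
      exact ⟨⟨U, hU, rfl⟩, hp⟩
  refine ⟨h.1.image _, ?_, ⟨⟨?_, ?_⟩, fun x => ?_⟩, fun x y => ?_⟩
  · rintro _ ⟨U, hU, rfl⟩
    exact hC.preimage e.continuous (h.2.1 U hU)
  · rintro ⟨U, hU, hne⟩
    rw [← preimage_univ (f := e)] at hne
    exact h.2.2.1.1.1 (hinj hne ▸ hU)
  · rw [sUnion_image, ← preimage_iUnion₂, ← sUnion_eq_biUnion, h.2.2.1.1.2, preimage_univ]
  · rw [heq]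
    exact (h.2.2.1.2 (e x)).image hinj.injOn
  · rw [heq, heq]
    exact (h.2.2.2 (e x) (e y)).imp (fun H => H.image _) fun H => H.image _

theorem SelectOne.tauCovers_of_homeomorph (hC : IsPointclass C) (e : X ≃ₜ Y)
    (h : SelectOne (tauCovers C X) (tauCovers C X)) :
    SelectOne (tauCovers C Y) (tauCovers C Y) := by
  intro 𝒰 h𝒰
  obtain ⟨V, hV, hVτ⟩ := h (fun n => preimage e '' 𝒰 n) fun n =>
    preimage_mem_tauCovers hC e (h𝒰 n)
  choose U hU hUV using hV
  obtain rfl : (fun n => e ⁻¹' U n) = V := funext hUV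
  refine ⟨U, hU, ?_⟩
  have := preimage_mem_tauCovers hC e.symm hVτ
  rwa [← range_comp, show preimage e.symm ∘ (fun n => e ⁻¹' U n) = U from
    funext fun n => by simp [← preimage_comp]] at this

theorem IsSetOfReals.of_homeomorph (hX : IsSetOfReals X) (e : X ≃ₜ Y) : IsSetOfReals Y where
  infinite := by
    have := hX.infinite
    exact Infinite.of_injective e e.injective
  metrizable := by
    have := hX.metrizable
    exact e.symm.isEmbedding.metrizableSpace
  separable := by
    have := hX.separable
    exact e.surjective.denseRange.separableSpace e.continuous
  zeroDimensional := by
    refine TopologicalSpace.isTopologicalBasis_of_isOpen_of_nhds (fun U hU => hU.isOpen)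
      fun y V hy hV => ?_
    obtain ⟨W, hW, hyW, hWV⟩ := hX.zeroDimensional.exists_subset_of_mem_open
      (a := e.symm y) (u := e ⁻¹' V) (by simpa) (hV.preimage e.continuous)
    exact ⟨e.symm ⁻¹' W, hW.preimage e.symm.continuous, hyW, fun z hz => by simpa using hWV hz⟩

theorem IsSetOfReals.prod_bool (hX : IsSetOfReals X) : IsSetOfReals (X × Bool) where
  infinite := by
    have := hX.infinite
    infer_instance
  metrizable := by
    have := hX.metrizable
    infer_instance
  separable := by
    have := hX.separable
    infer_instance
  zeroDimensional := by
    refine TopologicalSpace.isTopologicalBasis_of_isOpen_of_nhds (fun U hU => hU.isOpen)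
      fun y V hy hV => ?_
    obtain ⟨x, b⟩ := y
    obtain ⟨W, hW, hyW, hWV⟩ := hX.zeroDimensional.exists_subset_of_mem_open
      (a := x) (u := (fun z => (z, b)) ⁻¹' V) hy (hV.preimage (by fun_prop))
    refine ⟨W ×ˢ {b}, hW.prod (isClopen_discrete _), ⟨hyW, rfl⟩, ?_⟩
    rintro ⟨z, c⟩ ⟨hz, hc⟩
    obtain rfl : c = b := hc
    exact hWV hz

/-- A space is homeomorphic to each of its two copies in `X × Bool`. -/
def homeomorphSlice (X : Type u) [TopologicalSpace X] (b : Bool) :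
    X ≃ₜ {p : X × Bool | p.2 = b} where
  toFun x := ⟨(x, b), rfl⟩
  invFun p := p.1.1
  left_inv _ := rfl
  right_inv := by
    rintro ⟨⟨x, c⟩, hc⟩
    obtain rfl : c = b := hc
    rfl
  continuous_toFun := by fun_prop
  continuous_invFun := by fun_prop

/-- If `S₁(T, T)` is preserved by finite unions, it implies that `τ`-sequences have
`γ`-subsequences. -/
theorem SelectOne.hasGammaSubsequences_of_finiteUnions (hC : IsPointclass C)
    (hfin : PreservedByFiniteUnions.{u} fun X _ => SelectOne (tauCovers C X) (tauCovers C X))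
    (hX : IsSetOfReals X) (h : SelectOne (tauCovers C X) (tauCovers C X)) :
    HasGammaSubsequences C X := by
  intro U hUC hU
  have hY : SelectOne (tauCovers C (X × Bool)) (tauCovers C (X × Bool)) := by
    refine hfin (X × Bool) hX.prod_bool (range fun b => {p : X × Bool | p.2 = b})
      (finite_range _) ?_ ?_
    · exact eq_univ_of_forall fun p => ⟨_, ⟨p.2, rfl⟩, rfl⟩
    · rintro _ ⟨b, rfl⟩
      exact ⟨hX.of_homeomorph (homeomorphSlice X b),
        h.tauCovers_of_homeomorph hC (homeomorphSlice X b)⟩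
  let par : ℕ → Bool := fun n => decide (Odd n)
  -- At stage n only the copy labelled `par n` is tested; the other lies inside every W n m. The
  -- shift n + m makes the indices used unbounded.
  let W : ℕ → ℕ → Set (X × Bool) := fun n m => {p | p.2 = par n → p.1 ∈ U (n + m)}
  have hWeq : ∀ n m, W n m = Prod.snd ⁻¹' {par n}ᶜ ∪ Prod.fst ⁻¹' U (n + m) := fun n m => by
    ext p
    exact imp_iff_not_or
  have hWC : ∀ n m, C _ (W n m) := fun n m => by
    rw [hWeq]
    exact hC.union (hC.of_isClopen ((isClopen_discrete _).preimage continuous_snd))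
      (hC.preimage continuous_fst (hUC _))
  have hWτ : ∀ n, IsTauSeq (W n) := fun n => by
    have hshift : ∀ {p : ℕ → Prop}, (∀ᶠ m in cofinite, p m) → ∀ᶠ m in cofinite, p (n + m) :=
      fun hp => (add_right_injective n).tendsto_cofinite.eventually hp
    refine ⟨fun p => ?_, fun p q => ?_⟩
    · have hfr : ∃ᶠ m in cofinite, p.1 ∈ U (n + m) := by
        have := hU.1 p.1
        rw [Nat.cofinite_eq_atTop, frequently_atTop] at this ⊢
        intro a
        obtain ⟨b, hb, hpb⟩ := this (n + a)
        exact ⟨b - n, by lia, by rwa [Nat.add_sub_cancel' (by lia)]⟩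
      exact hfr.mono fun m hm _ => hm
    · by_cases hp : p.2 = par n
      · by_cases hq : q.2 = par n
        · exact (hU.2 p.1 q.1).imp
            (fun H => (hshift H).mono fun m hm hpm _ => hm (hpm hp))
            fun H => (hshift H).mono fun m hm hqm _ => hm (hqm hq)
        · exact Or.inl (Eventually.of_forall fun m _ hq' => (hq hq').elim)
      · exact Or.inr (Eventually.of_forall fun m _ hp' => (hp hp').elim)
  obtain ⟨f, hf⟩ := hY.exists_isTauSeq hX.prod_bool hC W hWC hWτ
  -- At even stages (x, true) is covered for free, so if it is almost below (y, false) then y lies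
  -- in almost all even terms; symmetrically at odd stages. Hence one x failing at odd stages makes
  -- every y succeed at even ones.
  have hdich : ∀ x y, (∀ᶠ n in cofinite, par n = false → y ∈ U (n + f n)) ∨
      ∀ᶠ n in cofinite, par n = true → x ∈ U (n + f n) := fun x y => by
    refine (hf.2 (x, true) (y, false)).imp (fun H => ?_) fun H => ?_
    · exact H.mono fun n hn hpar => hn (fun h' => by simp [hpar] at h') hpar.symm
    · exact H.mono fun n hn hpar => hn (fun h' => by simp [hpar] at h') hpar.symm
  have hfinish : ∀ b, (∀ a : ℕ, ∃ n ≥ a, par n = b) →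
      (∀ x, ∀ᶠ n in cofinite, par n = b → x ∈ U (n + f n)) →
      ∃ P : Set ℕ, P.Infinite ∧ ∀ x, ∀ᶠ n in cofinite, n ∈ P → x ∈ U n := fun b hb hx => by
    refine ⟨(fun n => n + f n) '' {n | par n = b}, ?_, fun x => ?_⟩
    · refine infinite_of_not_bddAbove fun ⟨a, ha⟩ => ?_
      obtain ⟨n, hn, hpar⟩ := hb (a + 1)
      have := ha ⟨n, hpar, rfl⟩
      simp only at this
      lia
    · refine ((hx x).image fun n => n + f n).subset ?_
      intro k hk
      have hk' : ¬ (k ∈ (fun n => n + f n) '' {n | par n = b} → x ∈ U k) := hk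
      push Not at hk'
      obtain ⟨⟨n, hn, rfl⟩, hxn⟩ := hk'
      exact ⟨n, fun H => hxn (H hn), rfl⟩
  by_cases hall : ∀ x, ∀ᶠ n in cofinite, par n = true → x ∈ U (n + f n)
  · exact hfinish true (fun a => ⟨2 * a + 1, by lia, by simp [par]⟩) hall
  · obtain ⟨x, hx⟩ := not_forall.1 hall
    exact hfinish false (fun a => ⟨2 * a, by lia, by simp [par]⟩)
      fun y => (hdich x y).resolve_right hx

end Homeomorphisms

/-! ### The equivalence for an arbitrary pointclass and its three instances. -/

section Equivalence

variable {C : ∀ (X : Type u) [TopologicalSpace X], Set X → Prop}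

theorem IsPointclass.tfae (hC : IsPointclass C) :
    List.TFAE [
      EquivalentProperties.{u} (fun X _ => SelectOne (tauCovers C X) (tauCovers C X))
        (fun X _ => SelectOne (tauCovers C X) (gammaCovers C X)),
      PreservedByFiniteUnions.{u} (fun X _ => SelectOne (tauCovers C X) (tauCovers C X)),
      PreservedByUnionsLtTower.{u} (fun X _ => SelectOne (tauCovers C X) (tauCovers C X))] := by
  tfae_have 1 → 3 := fun h X _ hX 𝒞 hcard hcov h𝒞 => by
    have hγ : ∀ A ∈ 𝒞, SelectOne (tauCovers C A) (gammaCovers C A) := fun A hA =>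
      (h A (h𝒞 A hA).1).1 (h𝒞 A hA).2
    refine (h X hX).2 (selectOne_tau_gamma hX ?_ ?_)
    · exact HasGammaSubsequences.of_sUnion hC hcard hcov fun A hA =>
        (hγ A hA).hasGammaSubsequences (h𝒞 A hA).1 hC
    · exact HasGammaSelections.of_sUnion hC hcard hcov fun A hA =>
        ((hγ A hA).mono gammaCovers_subset_tauCovers subset_rfl).hasGammaSelections
          (h𝒞 A hA).1 hC
  tfae_have 3 → 2 := fun h X _ hX 𝒞 hfin hcov h𝒞 => by
    refine h X hX 𝒞 ?_ hcov h𝒞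
    calc #𝒞 < ℵ₀ := Cardinal.lt_aleph0_iff_set_finite.2 hfin
      _ ≤ Cardinal.lift.{u} towerNumber := Cardinal.aleph0_le_lift.2 aleph0_le_towerNumber
  tfae_have 2 → 1 := fun h X _ hX => by
    refine ⟨fun hτ => ?_, fun hγ => hγ.mono subset_rfl gammaCovers_subset_tauCovers⟩
    have hsub := hτ.hasGammaSubsequences_of_finiteUnions hC h hX
    exact selectOne_tau_gamma hX hsub (hsub.hasGammaSelections hX hC hτ)
  tfae_finish

theorem isPointclass_isOpen : IsPointclass.{u} fun _ _ U => IsOpen U where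
  preimage hf hs := hs.preimage hf
  inter := IsOpen.inter
  union := IsOpen.union
  of_isClopen hs := hs.isOpen

theorem isPointclass_isClopen : IsPointclass.{u} fun _ _ U => IsClopen U where
  preimage hf hs := hs.preimage hf
  inter := IsClopen.inter
  union := IsClopen.union
  of_isClopen hs := hs

theorem isPointclass_borel : IsPointclass.{u} fun X _ U => @MeasurableSet X (borel X) U where
  preimage {X Y} _ _ f s hf hs := by
    borelize X Y
    exact hf.measurable hs
  inter {X} _ _ _ hs ht := @MeasurableSet.inter X (borel X) _ _ hs ht
  union {X} _ _ _ hs ht := @MeasurableSet.union X (borel X) _ _ hs ht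
  of_isClopen {X} _ _ hs := by
    borelize X
    exact hs.isOpen.measurableSet

end Equivalence

theorem mainTheorem8 :
    -- open covers
    List.TFAE [
      EquivalentProperties.{u} (fun X _ => SelectOne (openTau X) (openTau X))
        (fun X _ => SelectOne (openTau X) (openGamma X)),
      PreservedByFiniteUnions.{u} (fun X _ => SelectOne (openTau X) (openTau X)),
      PreservedByUnionsLtTower.{u} (fun X _ => SelectOne (openTau X) (openTau X))] ∧
    -- Borel covers
    List.TFAE [
      EquivalentProperties.{u} (fun X _ => SelectOne (borelTau X) (borelTau X))
        (fun X _ => SelectOne (borelTau X) (borelGamma X)),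
      PreservedByFiniteUnions.{u} (fun X _ => SelectOne (borelTau X) (borelTau X)),
      PreservedByUnionsLtTower.{u} (fun X _ => SelectOne (borelTau X) (borelTau X))] ∧
    -- clopen covers
    List.TFAE [
      EquivalentProperties.{u} (fun X _ => SelectOne (clopenTau X) (clopenTau X))
        (fun X _ => SelectOne (clopenTau X) (clopenGamma X)),
      PreservedByFiniteUnions.{u} (fun X _ => SelectOne (clopenTau X) (clopenTau X)),
      PreservedByUnionsLtTower.{u} (fun X _ => SelectOne (clopenTau X) (clopenTau X))] :=
  ⟨isPointclass_isOpen.tfae, isPointclass_borel.tfae, isPointclass_isClopen.tfae⟩
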